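/- Let $(X,d_X,\mu_X)$ be an mm-space, that is, a complete separable metric space $(X,d_X)$ with a Borel probability measure $\mu_X$, and let $\alpha\in(0,1)$. For a Borel probability measure $\mu$ on a metric space $Z$ put $$\operatorname{diam}(\mu;\alpha):=\inf\{\operatorname{diam}A \mid A\subset Z \text{ Borel},\ \mu(A)\ge\alpha\}\in[0,\infty],$$ and define the $\alpha$-partial diameter and the $\alpha$-observable diameter of $X$ by $$\operatorname{diam}(X;\alpha):=\operatorname{diam}(\mu_X;\alpha),\qquad \operatorname{Obsdiam}(X;\alpha):=\sup\{\operatorname{diam}(f_*\mu_X;\alpha)\mid f:X\to\mathbb{R}\ \text{is 1-Lipschitz}\},$$ where $f_*\mu_X$ is the push-forward of $\mu_X$ by $f$, a measure on $\mathbb{R}$ with its usual metric. Then the following are equivalent. 1. There exists a point $x\in X$ such that $\mu_X(\{x\})\ge\alpha$. 2. $\operatorname{diam}(X;\alpha)=0$. 3. $\operatorname{Obsdiam}(X;\alpha)=0$. -/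

import Mathlib

open MeasureTheory
open scoped ENNReal

/-- The `α`-partial diameter `diam(μ; α)` of a Borel measure `μ` on a metric space: the infimum, in
`[0, ∞]`, of the diameters of the Borel sets of measure at least `α`. -/
noncomputable def partialDiam {X : Type*} [MetricSpace X] [MeasurableSpace X]
    (μ : Measure X) (α : ℝ) : ℝ≥0∞ :=
  sInf {d : ℝ≥0∞ | ∃ A : Set X, MeasurableSet A ∧ ENNReal.ofReal α ≤ μ A ∧ d = Metric.ediam A}

/-- The `α`-observable diameter `Obsdiam(X; α)` of the metric measure space `(X, d, μ)`: the
supremum, in `[0, ∞]`, of the `α`-partial diameters of the push-forwards of `μ` under the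
`1`-Lipschitz functions `X → ℝ`. -/
noncomputable def obsDiam {X : Type*} [MetricSpace X] [MeasurableSpace X]
    (μ : Measure X) (α : ℝ) : ℝ≥0∞ :=
  sSup {d : ℝ≥0∞ | ∃ f : X → ℝ, LipschitzWith 1 f ∧ d = partialDiam (μ.map f) α}

open Filter Topology Set

/-! The substantial implication is 3 → 1. It rests on a single 1-Lipschitz `f` such that, for almost
every `x`, the fibre of `f` through `x` is `{x}` up to a null set
(`exists_lipschitzWith_ae_injective`). Vanishing observable diameter forces `μ.map f` to have an
atom of mass at least `α`; that fibre has positive measure, so it is a single point up to a null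
set.

To find `f`, take a dense sequence `a n` and `F s x = ∑ s ^ n * 2 ^ (-(n + 1)) * min (dist x (a n))
1`; the weights sum to 1, so `F s` is 1-Lipschitz for `s ∈ [0, 1]`. For `x ≠ y`, `F s x - F s y` is
a nonzero power series in `s`, so it vanishes only on a null set of `s`. By Fubini some `s`
separates almost all pairs of distinct points. -/

/-- A power series with bounded, not identically zero coefficients has almost no zeros in `(0, 1)`. -/
theorem ae_tsum_pow_mul_ne_zero {c : ℕ → ℝ} {C : ℝ} (hc : ∀ n, |c n| ≤ C) (h0 : c ≠ 0) :
    ∀ᵐ s ∂(volume.restrict (Ioo (0 : ℝ) 1)), ∑' n, s ^ n * c n ≠ 0 := by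
  set p := FormalMultilinearSeries.ofScalars ℝ c with hp
  have hsum : ∀ s : ℝ, p.sum s = ∑' n, s ^ n * c n := fun s => by
    have := FormalMultilinearSeries.ofScalars_sum_eq (E := ℝ) c s
    simp only [smul_eq_mul, mul_comm (c _)] at this
    exact this
  have hrad : (1 : ℝ≥0∞) ≤ p.radius := by
    refine p.le_radius_of_bound C (r := 1) fun n => ?_
    simpa [hp, FormalMultilinearSeries.ofScalars_norm] using hc n
  have hps := p.hasFPowerSeriesOnBall (zero_lt_one.trans_le hrad)
  have han : AnalyticOnNhd ℝ p.sum (Metric.ball 0 1) := by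
    refine hps.analyticOnNhd.mono ?_
    rw [← Metric.eball_ofReal, ENNReal.ofReal_one]
    exact Metric.eball_subset_eball hrad
  have hpre : IsConnected (Metric.ball (0 : ℝ) 1) :=
    ⟨⟨0, by simp⟩, (convex_ball _ _).isPreconnected⟩
  obtain ⟨x, hx, hx0⟩ : ∃ x ∈ Metric.ball (0 : ℝ) 1, p.sum x ≠ 0 := by
    by_contra! h
    apply h0
    rw [← FormalMultilinearSeries.ofScalars_series_eq_zero (𝕜 := ℝ) (E := ℝ)]
    refine hps.hasFPowerSeriesAt.eq_zero_of_eventually ?_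
    filter_upwards [Metric.ball_mem_nhds (0 : ℝ) one_pos] with y hy using h y hy
  -- By the identity theorem the zeros are isolated in the ball, hence form a null set.
  have hmem := han.preimage_zero_mem_codiscreteWithin hx0 hx hpre
  have hae := ae_restrict_le_codiscreteWithin (μ := volume) Metric.isOpen_ball.measurableSet hmem
  have hsub : Ioo (0 : ℝ) 1 ⊆ Metric.ball 0 1 := by
    rw [Real.ball_eq_Ioo]
    exact Ioo_subset_Ioo (by norm_num) (by norm_num)
  filter_upwards [ae_mono (Measure.restrict_mono_set volume hsub) hae] with s hs
  rw [← hsum]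
  exact hs

theorem hasSum_half_pow_succ : HasSum (fun n : ℕ => (1 / 2 : ℝ) ^ (n + 1)) 1 := by
  have := hasSum_geometric_two.mul_left (1 / 2 : ℝ)
  simpa [pow_succ'] using this

section Separating

variable {X : Type*} [MetricSpace X] [TopologicalSpace.SeparableSpace X] [Nonempty X]

/-- The coefficients of the power series `separatingFun`: weighted truncated distances to the points
of a dense sequence. -/
noncomputable def separatingCoeff (n : ℕ) (x : X) : ℝ :=
  (1 / 2) ^ (n + 1) * min (dist x (TopologicalSpace.denseSeq X n)) 1

/-- A family, indexed by `s ∈ [0, 1]`, of `1`-Lipschitz functions on `X`. Any two distinct points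
are separated by almost all of its members. -/
noncomputable def separatingFun (s : ℝ) (x : X) : ℝ :=
  ∑' n, s ^ n * separatingCoeff n x

theorem separatingCoeff_nonneg (n : ℕ) (x : X) : 0 ≤ separatingCoeff n x := by
  unfold separatingCoeff; positivity

theorem separatingCoeff_le (n : ℕ) (x : X) : separatingCoeff n x ≤ (1 / 2) ^ (n + 1) :=
  mul_le_of_le_one_right (by positivity) (min_le_right _ _)

theorem continuous_separatingCoeff (n : ℕ) : Continuous (separatingCoeff (X := X) n) := by
  unfold separatingCoeff; fun_prop

theorem abs_separatingCoeff_sub_le (n : ℕ) (x y : X) :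
    |separatingCoeff n x - separatingCoeff n y| ≤ (1 / 2) ^ (n + 1) * dist x y := by
  unfold separatingCoeff
  rw [← mul_sub, abs_mul, abs_of_pos (by positivity)]
  gcongr
  refine (abs_min_sub_min_le_max _ _ _ _).trans ?_
  simpa using abs_dist_sub_le x y _

theorem norm_separatingTerm_le {s : ℝ} (hs : s ∈ Icc (0 : ℝ) 1) (n : ℕ) (x : X) :
    ‖s ^ n * separatingCoeff n x‖ ≤ (1 / 2) ^ (n + 1) := by
  rw [Real.norm_of_nonneg (mul_nonneg (pow_nonneg hs.1 n) (separatingCoeff_nonneg n x))]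
  exact (mul_le_of_le_one_left (separatingCoeff_nonneg n x) (pow_le_one₀ hs.1 hs.2)).trans
    (separatingCoeff_le n x)

theorem summable_separatingTerm {s : ℝ} (hs : s ∈ Icc (0 : ℝ) 1) (x : X) :
    Summable fun n => s ^ n * separatingCoeff n x :=
  .of_norm_bounded hasSum_half_pow_succ.summable fun n => norm_separatingTerm_le hs n x

theorem separatingFun_sub {s : ℝ} (hs : s ∈ Icc (0 : ℝ) 1) (x y : X) :
    separatingFun s x - separatingFun s y =
      ∑' n, s ^ n * (separatingCoeff n x - separatingCoeff n y) := by
  simp only [separatingFun, mul_sub]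
  exact ((summable_separatingTerm hs x).tsum_sub (summable_separatingTerm hs y)).symm

theorem lipschitzWith_separatingFun {s : ℝ} (hs : s ∈ Icc (0 : ℝ) 1) :
    LipschitzWith 1 (separatingFun (X := X) s) := by
  refine LipschitzWith.of_dist_le_mul fun x y => ?_
  rw [Real.dist_eq, separatingFun_sub hs, NNReal.coe_one, ← Real.norm_eq_abs]
  refine tsum_of_norm_bounded (hasSum_half_pow_succ.mul_right (dist x y)) fun n => ?_
  rw [norm_mul, norm_pow, Real.norm_of_nonneg hs.1]
  exact (mul_le_of_le_one_left (norm_nonneg _) (pow_le_one₀ hs.1 hs.2)).trans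
    (abs_separatingCoeff_sub_le n x y)

theorem continuousOn_separatingFun :
    ContinuousOn (fun q : ℝ × X => separatingFun q.1 q.2) (Icc (0 : ℝ) 1 ×ˢ univ) := by
  refine continuousOn_tsum (fun n => ?_) hasSum_half_pow_succ.summable fun n q hq =>
    norm_separatingTerm_le hq.1 n q.2
  exact ((continuous_fst.pow n).mul
    ((continuous_separatingCoeff n).comp continuous_snd)).continuousOn

/-- A dense point closer to `x` than both `dist x y / 2` and 1 works: the truncation is inactive at
`x`, and the point cannot be equally close to `y`. -/
theorem exists_separatingCoeff_ne {x y : X} (hxy : x ≠ y) :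
    ∃ n, separatingCoeff n x ≠ separatingCoeff n y := by
  have hd : 0 < min (dist x y / 2) 1 := lt_min (half_pos (dist_pos.2 hxy)) one_pos
  obtain ⟨n, hn⟩ := (TopologicalSpace.denseRange_denseSeq X).exists_dist_lt x hd
  refine ⟨n, fun h => ?_⟩
  have h' := mul_left_cancel₀ (by positivity) h
  have htri := dist_triangle_right x y (TopologicalSpace.denseSeq X n)
  have h1 := hn.trans_le (min_le_left _ _)
  have h2 := hn.trans_le (min_le_right _ _)
  rw [min_eq_left h2.le] at h'
  rcases min_choice (dist y (TopologicalSpace.denseSeq X n)) 1 with h3 | h3 <;>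
    rw [h3] at h' <;> linarith

theorem ae_separatingFun_ne {x y : X} (hxy : x ≠ y) :
    ∀ᵐ s ∂(volume.restrict (Ioo (0 : ℝ) 1)), separatingFun s x ≠ separatingFun s y := by
  obtain ⟨n, hn⟩ := exists_separatingCoeff_ne hxy
  have hb : ∀ n, |separatingCoeff n x - separatingCoeff n y| ≤ dist x y := fun n =>
    (abs_separatingCoeff_sub_le n x y).trans
      (mul_le_of_le_one_left dist_nonneg (pow_le_one₀ (by norm_num) (by norm_num)))
  filter_upwards [ae_tsum_pow_mul_ne_zero hb fun h => hn (sub_eq_zero.1 (congrFun h n)),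
    ae_restrict_mem measurableSet_Ioo] with s hs hsI
  rw [← sub_ne_zero, separatingFun_sub (Ioo_subset_Icc_self hsI)]
  exact hs

end Separating

/-- Every finite Borel measure on a separable metric space admits a `1`-Lipschitz function that is
almost injective. -/
theorem exists_lipschitzWith_ae_injective {X : Type*} [MetricSpace X]
    [TopologicalSpace.SeparableSpace X] [MeasurableSpace X] [BorelSpace X]
    (μ : Measure X) [IsFiniteMeasure μ] :
    ∃ f : X → ℝ, LipschitzWith 1 f ∧ ∀ᵐ x ∂μ, ∀ᵐ y ∂μ, f x = f y → x = y := by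
  rcases isEmpty_or_nonempty X with hX | hX
  · exact ⟨isEmptyElim, LipschitzWith.of_dist_le_mul isEmptyElim, .of_forall isEmptyElim⟩
  have : SecondCountableTopology X := UniformSpace.secondCountable_of_separable X
  have hclosed : IsClosed ((Icc (0 : ℝ) 1 ×ˢ (univ : Set (X × X))) ∩
      (fun q : ℝ × X × X => separatingFun q.1 q.2.1 - separatingFun q.1 q.2.2) ⁻¹' {0}) := by
    refine ContinuousOn.preimage_isClosed_of_isClosed ?_ (isClosed_Icc.prod isClosed_univ)
      isClosed_singleton
    refine ContinuousOn.sub ?_ ?_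
    · exact continuousOn_separatingFun.comp (f := fun q : ℝ × X × X => (q.1, q.2.1))
        (by fun_prop) fun q hq => ⟨hq.1, trivial⟩
    · exact continuousOn_separatingFun.comp (f := fun q : ℝ × X × X => (q.1, q.2.2))
        (by fun_prop) fun q hq => ⟨hq.1, trivial⟩
  have hdiag : IsClosed {q : ℝ × X × X | q.2.1 = q.2.2} :=
    isClosed_eq (by fun_prop) (by fun_prop)
  -- The guard `q.1 ∈ Icc 0 1` is needed because joint continuity of `separatingFun` is known only
  -- there.
  have hmeas : MeasurableSet {q : ℝ × X × X | q.1 ∈ Icc (0 : ℝ) 1 →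
      separatingFun q.1 q.2.1 = separatingFun q.1 q.2.2 → q.2.1 = q.2.2} := by
    convert! hclosed.measurableSet.compl.union hdiag.measurableSet using 1
    ext q
    simp only [mem_ofPred_eq, mem_union, mem_compl_iff, mem_inter_iff, mem_prod, mem_univ, and_true,
      mem_preimage, mem_singleton_iff, sub_eq_zero]
    tauto
  have hae : ∀ᵐ s ∂(volume.restrict (Ioo (0 : ℝ) 1)), ∀ᵐ q ∂(μ.prod μ), s ∈ Icc (0 : ℝ) 1 →
      separatingFun s q.1 = separatingFun s q.2 → q.1 = q.2 := by
    rw [Measure.ae_ae_comm hmeas]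
    refine .of_forall fun q => ?_
    by_cases hq : q.1 = q.2
    · exact .of_forall fun s _ _ => hq
    · filter_upwards [ae_separatingFun_ne hq] with s hs _ h using absurd h hs
  have hne : NeBot (ae (volume.restrict (Ioo (0 : ℝ) 1))) := by
    rw [ae_neBot, Ne, Measure.restrict_eq_zero]
    simp
  obtain ⟨s, hs, hsI⟩ := (hae.and (ae_restrict_mem measurableSet_Ioo)).exists
  have hsI' := Ioo_subset_Icc_self hsI
  refine ⟨separatingFun s, lipschitzWith_separatingFun hsI', ?_⟩
  filter_upwards [Measure.ae_ae_of_ae_prod hs] with x hx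
  filter_upwards [hx] with y hy using hy hsI'

theorem exists_measurableSet_ediam_lt {X : Type*} [MetricSpace X] [MeasurableSpace X]
    {μ : Measure X} {α : ℝ} {ε : ℝ≥0∞} (h : partialDiam μ α < ε) :
    ∃ A, MeasurableSet A ∧ ENNReal.ofReal α ≤ μ A ∧ Metric.ediam A < ε := by
  obtain ⟨_, ⟨A, hA, hα, rfl⟩, hlt⟩ := sInf_lt_iff.1 h
  exact ⟨A, hA, hα, hlt⟩

theorem partialDiam_le {X : Type*} [MetricSpace X] [MeasurableSpace X]
    {μ : Measure X} {α : ℝ} {A : Set X} (hA : MeasurableSet A) (hα : ENNReal.ofReal α ≤ μ A) :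
    partialDiam μ α ≤ Metric.ediam A :=
  sInf_le ⟨A, hA, hα, rfl⟩

/-- On a Polish space, a finite measure with vanishing partial diameter has a large atom. -/
theorem exists_le_measure_singleton_of_partialDiam_eq_zero {X : Type*} [MetricSpace X]
    [CompleteSpace X] [TopologicalSpace.SeparableSpace X] [MeasurableSpace X] [BorelSpace X]
    {μ : Measure X} [IsFiniteMeasure μ] {α : ℝ} (hα : 0 < α) (h : partialDiam μ α = 0) :
    ∃ x, ENNReal.ofReal α ≤ μ {x} := by
  have : SecondCountableTopology X := UniformSpace.secondCountable_of_separable X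
  -- Tightness gives a compact `K` whose complement has mass below `α`, so every set of mass at
  -- least `α` meets `K`.
  obtain ⟨K, hK, hKμ⟩ := isTightMeasureSet_iff_exists_isCompact_measure_compl_le.1
    (isTightMeasureSet_singleton (μ := μ)) (ENNReal.ofReal (α / 2)) (by simpa using hα)
  replace hKμ : μ Kᶜ < ENNReal.ofReal α := (hKμ μ rfl).trans_lt
    ((ENNReal.ofReal_lt_ofReal_iff hα).2 (half_lt_self hα))
  obtain ⟨u, -, hu0, hu⟩ := exists_seq_strictAnti_tendsto (0 : ℝ)
  have hA : ∀ n, ∃ A, MeasurableSet A ∧ ENNReal.ofReal α ≤ μ A ∧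
      Metric.ediam A < ENNReal.ofReal (u n) := fun n =>
    exists_measurableSet_ediam_lt (by rw [h]; exact ENNReal.ofReal_pos.2 (hu0 n))
  choose A _ hAα hAd using hA
  have hAK : ∀ n, (A n ∩ K).Nonempty := fun n => by
    by_contra hne
    rw [← disjoint_iff_inter_eq_empty.trans not_nonempty_iff_eq_empty.symm,
      ← subset_compl_iff_disjoint_right] at hne
    exact ((measure_mono hne).trans_lt hKμ).not_ge (hAα n)
  choose a ha using hAK
  obtain ⟨x, -, φ, hφ, hlim⟩ := hK.tendsto_subseq fun n => (ha n).2
  -- `μ {x}` is the limit of the masses of closed balls around `x`; each such ball contains some `A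
  -- (φ n)`, of mass at least `α`.
  refine ⟨x, ge_of_tendsto ((tendsto_measure_cthickening_of_isClosed
    ⟨1, one_pos, measure_ne_top μ _⟩ isClosed_singleton).mono_left
      (nhdsWithin_le_nhds (s := Ioi (0 : ℝ)))) ?_⟩
  filter_upwards [self_mem_nhdsWithin] with r hr
  rw [Metric.cthickening_singleton x (le_of_lt hr)]
  obtain ⟨n, hn1, hn2⟩ := ((hlim.eventually (Metric.ball_mem_nhds x (half_pos hr))).and
    ((hu.comp hφ.tendsto_atTop).eventually (gt_mem_nhds (half_pos hr)))).exists
  refine (hAα (φ n)).trans (measure_mono fun y hy => ?_)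
  have hd : edist y (a (φ n)) < ENNReal.ofReal (u (φ n)) :=
    (Metric.edist_le_ediam_of_mem hy (ha (φ n)).1).trans_lt (hAd (φ n))
  rw [edist_dist, ENNReal.ofReal_lt_ofReal_iff (hu0 _)] at hd
  have htri := dist_triangle y (a (φ n)) x
  simp only [Function.comp_apply] at hn1 hn2
  rw [Metric.mem_closedBall]
  linarith

/-- Partial diameters do not increase under `1`-Lipschitz maps. -/
theorem partialDiam_map_le {X Y : Type*} [MetricSpace X] [MeasurableSpace X] [BorelSpace X]
    [MetricSpace Y] [MeasurableSpace Y] [BorelSpace Y]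
    (μ : Measure X) (α : ℝ) {f : X → Y} (hf : LipschitzWith 1 f) :
    partialDiam (μ.map f) α ≤ partialDiam μ α := by
  refine le_sInf ?_
  rintro _ ⟨A, -, hα, rfl⟩
  -- `f '' A` need not be Borel; its closure is, and has the same diameter.
  have hcl : MeasurableSet (closure (f '' A)) := isClosed_closure.measurableSet
  refine (partialDiam_le hcl (hα.trans ?_)).trans ?_
  · rw [Measure.map_apply hf.continuous.measurable hcl]
    exact measure_mono fun x hx => subset_closure (mem_image_of_mem f hx)
  · rw [Metric.ediam_closure]
    simpa using hf.ediam_image_le A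

theorem partialDiam_map_le_obsDiam {X : Type*} [MetricSpace X] [MeasurableSpace X]
    (μ : Measure X) (α : ℝ) {f : X → ℝ} (hf : LipschitzWith 1 f) :
    partialDiam (μ.map f) α ≤ obsDiam μ α :=
  le_sSup ⟨f, hf, rfl⟩

theorem obsDiam_le_partialDiam {X : Type*} [MetricSpace X] [MeasurableSpace X] [BorelSpace X]
    (μ : Measure X) (α : ℝ) : obsDiam μ α ≤ partialDiam μ α := by
  refine sSup_le ?_
  rintro _ ⟨f, hf, rfl⟩
  exact partialDiam_map_le μ α hf

theorem exists_le_measure_singleton_of_obsDiam_eq_zero {X : Type*} [MetricSpace X]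
    [TopologicalSpace.SeparableSpace X] [MeasurableSpace X] [BorelSpace X]
    {μ : Measure X} [IsFiniteMeasure μ] {α : ℝ} (hα : 0 < α) (h : obsDiam μ α = 0) :
    ∃ x, ENNReal.ofReal α ≤ μ {x} := by
  obtain ⟨f, hf, hinj⟩ := exists_lipschitzWith_ae_injective μ
  obtain ⟨t, ht⟩ := exists_le_measure_singleton_of_partialDiam_eq_zero hα
    (le_antisymm ((partialDiam_map_le_obsDiam μ α hf).trans_eq h) bot_le)
  rw [Measure.map_apply hf.continuous.measurable (measurableSet_singleton t)] at ht
  have hpos : μ (f ⁻¹' {t}) ≠ 0 := ((ENNReal.ofReal_pos.2 hα).trans_le ht).ne'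
  -- A fibre of positive measure contains a point at which almost injectivity holds.
  obtain ⟨x, hxt, hx⟩ := ((frequently_ae_mem_iff.2 hpos).and_eventually hinj).exists
  refine ⟨x, ht.trans (measure_mono_ae ?_)⟩
  filter_upwards [hx] with y hy hyt
  exact (hy (hxt.trans hyt.symm)).symm

theorem theorem1 {X : Type*} [MetricSpace X] [CompleteSpace X]
    [TopologicalSpace.SeparableSpace X] [MeasurableSpace X] [BorelSpace X]
    (μ : Measure X) [IsProbabilityMeasure μ] (α : ℝ) (hα : α ∈ Set.Ioo (0 : ℝ) 1) :
    List.TFAE [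
      ∃ x : X, ENNReal.ofReal α ≤ μ {x},
      partialDiam μ α = 0,
      obsDiam μ α = 0] := by
  tfae_have 1 → 2 := fun ⟨x, hx⟩ =>
    le_antisymm ((partialDiam_le (measurableSet_singleton x) hx).trans_eq
      Metric.ediam_singleton) bot_le
  tfae_have 2 → 3 := fun h => le_antisymm ((obsDiam_le_partialDiam μ α).trans_eq h) bot_le
  tfae_have 3 → 1 := exists_le_measure_singleton_of_obsDiam_eq_zero hα.1
  tfae_finish
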